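/- Let $E$ be a finite-dimensional complex Hilbert space, let $\mathcal L(E)$ be the algebra of linear operators on $E$, and let $\mathbb T$ be the unit circle with normalized Lebesgue measure. For $F=E$ or $F=\mathcal L(E)$, let $H^2(F)\subset L^2(F)$ be the space of square-integrable $F$-valued functions on $\mathbb T$ whose Fourier coefficients of negative index vanish, and let $H^\infty(\mathcal L(E))$ be the space of essentially bounded $\mathcal L(E)$-valued functions on $\mathbb T$ with the same property; such functions are identified with their analytic extensions to the unit disc. A function $\Theta\in H^\infty(\mathcal L(E))$ is called inner if $\Theta(\zeta)$ is an isometry for almost every $\zeta\in\mathbb T$, and pure if $\|\Theta(0)\|<1$. For an inner function $\Theta$ put $K_\Theta=H^2(E)\ominus\Theta H^2(E)$, let $P_\Theta$ be the orthogonal projection of $L^2(E)$ onto $K_\Theta$, and let $K_\Theta^\infty$ be the set of essentially bounded functions in $K_\Theta$. **Theorem.** Let $\Theta_1,\Theta_2$ be nonconstant pure $\mathcal L(E)$-valued inner functions, let $\Phi\in L^2(\mathcal L(E))$, and let $A_\Phi^{\Theta_1,\Theta_2}:K_{\Theta_1}\to K_{\Theta_2}$ be a bounded matrix valued asymmetric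 truncated Toeplitz operator with symbol $\Phi$, that is, a bounded linear operator with $$A_\Phi^{\Theta_1,\Theta_2}f=P_{\Theta_2}(\Phi f)\qquad\text{for all } f\in K_{\Theta_1}^\infty .$$ Then $A_\Phi^{\Theta_1,\Theta_2}=0$ if and only if $$\Phi\in[\Theta_1H^2(\mathcal L(E))]^*+\Theta_2H^2(\mathcal L(E)),$$ that is, if and only if there are $\Phi_1,\Phi_2\in H^2(\mathcal L(E))$ such that $\Phi=(\Theta_1\Phi_1)^*+\Theta_2\Phi_2$ almost everywhere on $\mathbb T$, where $^*$ denotes the pointwise adjoint. -/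

import Mathlib

open MeasureTheory
open scoped ENNReal Pointwise

noncomputable section

namespace MatrixATTO

instance fact_two_pi_pos : Fact (0 < 2 * Real.pi) := ⟨Real.two_pi_pos⟩

/-- The unit circle, parametrised by the angle `t` modulo `2π` (the point is `e^{it}`). -/
abbrev UnitCirc : Type := AddCircle (2 * Real.pi)

/-- Normalised Lebesgue measure `dt / 2π` on the circle. -/
abbrev arcMeasure : Measure UnitCirc := AddCircle.haarAddCircle

/-- `L^p(F)`: (classes of) `p`-integrable functions on the circle with values in `F`. -/
abbrev LpC (F : Type*) [NormedAddCommGroup F] (p : ℝ≥0∞) : Type _ := Lp F p arcMeasure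

/-- For `1 ≤ p`, an `L^p` function on the circle is integrable. -/
theorem integrable_of_LpC {F : Type*} [NormedAddCommGroup F] {p : ℝ≥0∞} [hp : Fact (1 ≤ p)] (f : LpC F p) :
    Integrable f arcMeasure :=
  (Lp.memLp f).integrable hp.out

section Hardy

variable {F : Type*} [NormedAddCommGroup F] [NormedSpace ℂ F]

/-- The Hardy space `H^p(F)`, as the space of those `f ∈ L^p(F)` all of whose Fourier coefficients
of negative index vanish. -/
def hardy (F : Type*) [NormedAddCommGroup F] [NormedSpace ℂ F] (p : ℝ≥0∞) [Fact (1 ≤ p)] :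
    Submodule ℂ (LpC F p) where
  carrier := {f | ∀ n : ℤ, n < 0 → fourierCoeff (f : UnitCirc → F) n = 0}
  zero_mem' := fun n _ => by
    rw [fourierCoeff_congr_ae (Lp.coeFn_zero F p arcMeasure)]
    simp [fourierCoeff]
  add_mem' := fun {f g} hf hg n hn => by
    rw [fourierCoeff_congr_ae (Lp.coeFn_add f g),
      fourierCoeff.add (integrable_of_LpC f) (integrable_of_LpC g), Pi.add_apply, hf n hn, hg n hn,
      add_zero]
  smul_mem' := fun c f hf n hn => by
    rw [fourierCoeff_congr_ae (Lp.coeFn_smul c f), fourierCoeff.const_smul, hf n hn, smul_zero]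

/-- The value at the point `z` of the open unit disc of the analytic function
`∑ aₙ zⁿ` whose Taylor coefficients are the Fourier coefficients `aₙ`, `n ≥ 0`, of `f`. -/
def discValue (f : UnitCirc → F) (z : ℂ) : F :=
  ∑' n : ℕ, z ^ n • fourierCoeff f (n : ℤ)

theorem discValue_zero (f : UnitCirc → F) : discValue f 0 = fourierCoeff f 0 := by
  unfold discValue
  rw [tsum_eq_single 0 (fun n hn => by simp [hn])]
  simp

theorem norm_fourierCoeff_le {p : ℝ≥0∞} [hp : Fact (1 ≤ p)] (f : LpC F p) (n : ℤ) :
    ‖fourierCoeff (f : UnitCirc → F) n‖ ≤ ‖f‖ := by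
  have h1 : ‖fourierCoeff (f : UnitCirc → F) n‖ ≤ ∫ t, ‖f t‖ ∂arcMeasure := by
    unfold fourierCoeff
    refine (norm_integral_le_integral_norm _).trans (le_of_eq ?_)
    refine integral_congr_ae (Filter.Eventually.of_forall fun t => ?_)
    beta_reduce
    rw [norm_smul, fourier_apply, Circle.norm_coe, one_mul]
  refine h1.trans ?_
  rw [integral_norm_eq_lintegral_enorm (Lp.aestronglyMeasurable f), ← eLpNorm_one_eq_lintegral_enorm,
    Lp.norm_def]
  exact ENNReal.toReal_mono (Lp.eLpNorm_ne_top f)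
    (eLpNorm_le_eLpNorm_of_exponent_le hp.out (Lp.aestronglyMeasurable f))

theorem isClosed_hardy (F : Type*) [NormedAddCommGroup F] [NormedSpace ℂ F] (p : ℝ≥0∞)
    [Fact (1 ≤ p)] : IsClosed (hardy F p : Set (LpC F p)) := by
  refine isClosed_of_closure_subset fun f hf n hn => ?_
  refine norm_le_zero_iff.1 (le_of_forall_pos_le_add fun ε hε => ?_)
  obtain ⟨g, hg, hfg⟩ := Metric.mem_closure_iff.1 hf ε hε
  have hsub : fourierCoeff ((f - g : LpC F p) : UnitCirc → F) n
      = fourierCoeff (f : UnitCirc → F) n := by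
    have h := fourierCoeff.add (integrable_of_LpC (f - g)) (integrable_of_LpC g)
    rw [← fourierCoeff_congr_ae (Lp.coeFn_add (f - g) g), sub_add_cancel] at h
    rw [h, Pi.add_apply, hg n hn, add_zero]
  rw [← hsub, zero_add]
  exact (norm_fourierCoeff_le _ n).trans (by rw [← dist_eq_norm]; exact hfg.le)

end Hardy

section Operators

variable {E : Type*} [NormedAddCommGroup E] [InnerProductSpace ℂ E]

/-- `Φ f`: the pointwise application `t ↦ Φ(t) f(t)` of an operator valued function
to a vector valued function. -/
def mulVec {p q : ℝ≥0∞} (r : ℝ≥0∞) [ENNReal.HolderTriple p q r]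
    (Φ : LpC (E →L[ℂ] E) p) (f : LpC E q) : LpC E r :=
  (ContinuousLinearMap.id ℂ (E →L[ℂ] E)).holder r Φ f

/-- `Θ H²(E) = {Θ f : f ∈ H²(E)}`. -/
def mulHardyVec (Θ : LpC (E →L[ℂ] E) ∞) : Submodule ℂ (LpC E 2) :=
  (hardy E 2).map ((ContinuousLinearMap.id ℂ (E →L[ℂ] E)).holderₗ arcMeasure ∞ 2 2 Θ)

/-- `Θ H²(L(E)) = {Θ F : F ∈ H²(L(E))}`, the product being the pointwise composition. -/
def mulHardyOp (Θ : LpC (E →L[ℂ] E) ∞) : Submodule ℂ (LpC (E →L[ℂ] E) 2) :=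
  (hardy (E →L[ℂ] E) 2).map ((ContinuousLinearMap.compL ℂ E E E).holderₗ arcMeasure ∞ 2 2 Θ)

/-- `Θ ∈ H^∞(L(E))` is inner if its boundary values are isometries almost everywhere. -/
structure IsInner (Θ : LpC (E →L[ℂ] E) ∞) : Prop where
  mem_hardy : Θ ∈ hardy (E →L[ℂ] E) ∞
  isometry : ∀ᵐ t ∂arcMeasure, Isometry (Θ t)

/-- `Θ` is not (almost everywhere equal to) a constant. -/
def IsNonconstant (Θ : LpC (E →L[ℂ] E) ∞) : Prop :=
  ¬ ∃ W : E →L[ℂ] E, ∀ᵐ t ∂arcMeasure, Θ t = W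

/-- `Θ` is pure: `‖Θ(0)‖ < 1`. -/
def IsPure (Θ : LpC (E →L[ℂ] E) ∞) : Prop :=
  ‖discValue (Θ : UnitCirc → (E →L[ℂ] E)) 0‖ < 1

/-- The model space `K_Θ = H²(E) ⊖ Θ H²(E)`. -/
def modelSpace (Θ : LpC (E →L[ℂ] E) ∞) : Submodule ℂ (LpC E 2) :=
  hardy E 2 ⊓ (mulHardyVec Θ)ᗮ

instance completeSpace_modelSpace [CompleteSpace E] (Θ : LpC (E →L[ℂ] E) ∞) :
    CompleteSpace (modelSpace Θ) := by
  have h : IsClosed (modelSpace Θ : Set (LpC E 2)) := by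
    unfold modelSpace
    rw [Submodule.coe_inf]
    exact (isClosed_hardy E 2).inter (Submodule.isClosed_orthogonal _)
  exact h.completeSpace_coe

/-- The bounded operator `A : K_{Θ₁} → K_{Θ₂}` is the asymmetric truncated Toeplitz operator
`A_Φ^{Θ₁,Θ₂}` with symbol `Φ ∈ L²(L(E))`: it is given by `A f = P_{Θ₂}(Φ f)` for `f` in
`K_{Θ₁}^∞`, the essentially bounded functions in `K_{Θ₁}`, where `P_{Θ₂}` is the orthogonal
projection onto `K_{Θ₂}`. -/
def IsATTO [CompleteSpace E] (Θ₁ Θ₂ : LpC (E →L[ℂ] E) ∞) (Φ : LpC (E →L[ℂ] E) 2)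
    (A : modelSpace Θ₁ →L[ℂ] modelSpace Θ₂) : Prop :=
  ∀ (f : modelSpace Θ₁) (hf : MemLp ((f : LpC E 2) : UnitCirc → E) ∞ arcMeasure),
    A f = (modelSpace Θ₂).orthogonalProjectionOnto (mulVec 2 Φ (hf.toLp _))

end Operators

end MatrixATTO

end

/-! If `Φ = (Θ₁Γ₁)^* + Θ₂Γ₂`, then for bounded `f ∈ K_{Θ₁}` and `g ∈ K_{Θ₂}` the pairing `⟨g, Φf⟩`
equals `⟨Θ₁(Γ₁g), f⟩ + ⟨g, Θ₂(Γ₂f)⟩`, and both terms vanish by the definition of the model spaces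
(`isNullSymbol_of_ae_eq`).

Conversely, let all these pairings vanish. Model spaces are invariant under the backward shift `f ↦
z̄(f - f(0))`, and the unimodular factors cancel in a pairing of two shifted functions. Comparing
the pairings of `(f, g)` and of the shifted pair leaves `∫⟨g, Φf(0)⟩ + ∫⟨g(0), Φf⟩ = ⟨g(0),
Φ̂(0)f(0)⟩` (`IsNullSymbol.integral_add_integral`). Purity makes `f(0)` range over all of `E`
(`IsInnerFun.exists_isModel_fourierCoeff_zero_eq`). Fixing `f` with `f(0) = x`, the identity says
that `Φx` minus a constant vector is orthogonal to the bounded part of `K_{Θ₂}`, so its analytic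
part lies in `Θ₂H²(E)` (`IsInnerFun.exists_isHardy_of_orthogonal`). Over a basis of `E` this
determines the coefficients of `Φ` of index `≥ 0` up to a constant `M`. The same argument for `Φ^*`
gives those of index `≤ 0` up to a constant `N`. The identity then forces `M + N^* = Φ̂(0)`, exactly
what is needed for the two halves to add up to `Φ`.

Passing between the operator and the pairings requires that bounded functions suffice to test
orthogonality to `K_Θ`. The functions `zⁿx - Θp`, with `p` a polynomial, do this. -/

noncomputable section

namespace MatrixATTO

/-! ### Fourier coefficients of vector valued functions. -/

section FourierCoefficients

variable {F G : Type*} [NormedAddCommGroup F] [NormedSpace ℂ F] [NormedAddCommGroup G]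
  [NormedSpace ℂ G]

theorem fourierCoeff_clm_apply [CompleteSpace F] [CompleteSpace G] (L : F →L[ℂ] G)
    {f : UnitCirc → F} (hf : Integrable f arcMeasure) (n : ℤ) :
    fourierCoeff (fun t => L (f t)) n = L (fourierCoeff f n) := by
  unfold fourierCoeff
  rw [← L.integral_comp_comm (hf.fourier_smul _)]
  simp only [map_smul]

theorem fourierCoeff_fun_add {f g : UnitCirc → F} (hf : Integrable f arcMeasure)
    (hg : Integrable g arcMeasure) (n : ℤ) :
    fourierCoeff (fun t => f t + g t) n = fourierCoeff f n + fourierCoeff g n :=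
  congrFun (fourierCoeff.add hf hg) n

theorem fourierCoeff_fun_sub {f g : UnitCirc → F} (hf : Integrable f arcMeasure)
    (hg : Integrable g arcMeasure) (n : ℤ) :
    fourierCoeff (fun t => f t - g t) n = fourierCoeff f n - fourierCoeff g n := by
  have h := fourierCoeff_fun_add (hf.sub hg) hg n
  simp only [Pi.sub_apply, sub_add_cancel] at h
  rw [h, add_sub_cancel_right]
  rfl

theorem fourierCoeff_fun_sum {ι : Type*} (s : Finset ι) {f : ι → UnitCirc → F}
    (hf : ∀ i ∈ s, Integrable (f i) arcMeasure) (n : ℤ) :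
    fourierCoeff (fun t => ∑ i ∈ s, f i t) n = ∑ i ∈ s, fourierCoeff (f i) n := by
  have h := congrFun (fourierCoeff.sum s f hf) n
  rw [Finset.sum_apply] at h
  rw [← h]
  congr 1
  ext t
  simp

theorem fourierCoeff_fourier_smul (k : ℤ) (f : UnitCirc → F) (n : ℤ) :
    fourierCoeff (fun t => fourier k t • f t) n = fourierCoeff f (n - k) := by
  unfold fourierCoeff
  congr 1
  ext t
  rw [smul_smul, ← fourier_add]
  congr 3
  ring

theorem fourierCoeff_const [CompleteSpace F] (x : F) (n : ℤ) :
    fourierCoeff (fun _ : UnitCirc => x) n = if n = 0 then x else 0 := by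
  have h := orthonormal_iff_ite.1 (orthonormal_fourier (T := 2 * Real.pi)) n 0
  rw [L2.inner_def] at h
  have h2 : ∫ t : UnitCirc, fourier (-n) t ∂arcMeasure = if n = 0 then 1 else 0 := by
    rw [← h]
    refine integral_congr_ae ?_
    filter_upwards [coeFn_fourierLp (T := 2 * Real.pi) 2 n, coeFn_fourierLp (T := 2 * Real.pi) 2 0]
      with t h1 h2
    rw [h1, h2, RCLike.inner_apply, fourier_zero, one_mul, fourier_neg]
  unfold fourierCoeff
  rw [integral_smul_const, h2]
  split_ifs <;> simp

theorem memLp_fourier_smul {p : ℝ≥0∞} (k : ℤ) {f : UnitCirc → F} (hf : MemLp f p arcMeasure) :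
    MemLp (fun t => fourier k t • f t) p arcMeasure := by
  refine hf.congr_norm ((fourier k).continuous.aestronglyMeasurable.smul
    hf.aestronglyMeasurable) (Filter.Eventually.of_forall fun t => ?_)
  rw [norm_smul, fourier_apply, Circle.norm_coe, one_mul]

theorem MemLp.integrable_of_two {F : Type*} [NormedAddCommGroup F] {f : UnitCirc → F} (hf : MemLp f 2 arcMeasure) :
    Integrable f arcMeasure :=
  hf.integrable (by norm_num)

end FourierCoefficients

/-! ### Orthogonality of disjoint spectra, boundary functions of `H²`, Riesz projection. -/

section Hilbert

variable {E : Type*} [NormedAddCommGroup E] [InnerProductSpace ℂ E]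

theorem MemLp.integrable_inner_two {f g : UnitCirc → E} (hf : MemLp f 2 arcMeasure)
    (hg : MemLp g 2 arcMeasure) : Integrable (fun t => inner ℂ (f t) (g t)) arcMeasure := by
  refine (L2.integrable_inner (𝕜 := ℂ) (hf.toLp f) (hg.toLp g)).congr ?_
  filter_upwards [hf.coeFn_toLp, hg.coeFn_toLp] with t h1 h2
  rw [h1, h2]

theorem inner_toLp {f g : UnitCirc → E} (hf : MemLp f 2 arcMeasure)
    (hg : MemLp g 2 arcMeasure) :
    inner ℂ (hf.toLp f) (hg.toLp g) = ∫ t, inner ℂ (f t) (g t) ∂arcMeasure := by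
  rw [L2.inner_def]
  refine integral_congr_ae ?_
  filter_upwards [hf.coeFn_toLp, hg.coeFn_toLp] with t h1 h2
  rw [h1, h2]

theorem integral_inner_conj (f g : UnitCirc → E) :
    ∫ t, inner ℂ (f t) (g t) ∂arcMeasure
      = (starRingEnd ℂ) (∫ t, inner ℂ (g t) (f t) ∂arcMeasure) := by
  rw [← integral_conj]
  simp

theorem integral_inner_eq_zero_comm (f g : UnitCirc → E) :
    ∫ t, inner ℂ (f t) (g t) ∂arcMeasure = 0 ↔ ∫ t, inner ℂ (g t) (f t) ∂arcMeasure = 0 := by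
  rw [integral_inner_conj f g, map_eq_zero]

variable [CompleteSpace E]

theorem inner_fourierCoeff (x : E) {f : UnitCirc → E} (hf : Integrable f arcMeasure) (n : ℤ) :
    inner ℂ x (fourierCoeff f n) = ∫ t, inner ℂ (fourier n t • x) (f t) ∂arcMeasure := by
  unfold fourierCoeff
  rw [← integral_inner (hf.fourier_smul _)]
  congr 1
  ext t
  rw [inner_smul_left, inner_smul_right, fourier_neg]

theorem inner_fourierCoeff_zero (x : E) {f : UnitCirc → E} (hf : Integrable f arcMeasure) :
    inner ℂ x (fourierCoeff f 0) = ∫ t, inner ℂ x (f t) ∂arcMeasure := by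
  rw [inner_fourierCoeff x hf]
  simp_rw [fourier_zero, one_smul]

theorem inner_fourierCoeff_zero_left (x : E) {f : UnitCirc → E} (hf : Integrable f arcMeasure) :
    inner ℂ (fourierCoeff f 0) x = ∫ t, inner ℂ (f t) x ∂arcMeasure := by
  rw [integral_inner_conj, ← inner_fourierCoeff_zero x hf, inner_conj_symm]

/-- Square integrable functions with disjoint spectra are orthogonal: the scalar case. -/
theorem integral_conj_mul_eq_zero {f g : UnitCirc → ℂ} (hf : MemLp f 2 arcMeasure)
    (hg : MemLp g 2 arcMeasure) (h : ∀ n, fourierCoeff f n = 0 ∨ fourierCoeff g n = 0) :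
    ∫ t, inner ℂ (f t) (g t) ∂arcMeasure = 0 := by
  rw [← inner_toLp hf hg]
  have hs := (fourierBasis (T := 2 * Real.pi)).hasSum_inner_mul_inner (hf.toLp f) (hg.toLp g)
  refine hs.unique ?_
  convert hasSum_zero with n
  have h1 := fourierBasis_repr (T := 2 * Real.pi) (hf.toLp f) n
  have h2 := fourierBasis_repr (T := 2 * Real.pi) (hg.toLp g) n
  rw [HilbertBasis.repr_apply_apply, fourierCoeff_congr_ae hf.coeFn_toLp] at h1
  rw [HilbertBasis.repr_apply_apply, fourierCoeff_congr_ae hg.coeFn_toLp] at h2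
  rw [h2, ← inner_conj_symm, h1]
  rcases h n with h | h <;> simp [h]

theorem integral_inner_eq_zero_of_disjoint [FiniteDimensional ℂ E]
    {f g : UnitCirc → E} (hf : MemLp f 2 arcMeasure)
    (hg : MemLp g 2 arcMeasure) (h : ∀ n, fourierCoeff f n = 0 ∨ fourierCoeff g n = 0) :
    ∫ t, inner ℂ (f t) (g t) ∂arcMeasure = 0 := by
  let b := stdOrthonormalBasis ℂ E
  have key : ∀ (i) {f : UnitCirc → E}, MemLp f 2 arcMeasure →
      MemLp (fun t => inner ℂ (b i) (f t)) 2 arcMeasure := fun i f hf =>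
    (innerSL ℂ (b i)).comp_memLp' hf
  have hc : ∀ (i) (n) {f : UnitCirc → E}, MemLp f 2 arcMeasure →
      fourierCoeff (fun t => inner ℂ (b i) (f t)) n = inner ℂ (b i) (fourierCoeff f n) :=
    fun i n f hf => fourierCoeff_clm_apply (innerSL ℂ (b i)) (MemLp.integrable_of_two hf) n
  have he : ∀ t, inner ℂ (f t) (g t)
      = ∑ i, inner ℂ (inner ℂ (b i) (f t)) (inner ℂ (b i) (g t)) := fun t => by
    rw [← b.sum_inner_mul_inner]
    refine Finset.sum_congr rfl fun i _ => ?_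
    rw [RCLike.inner_apply, inner_conj_symm, mul_comm]
  simp_rw [he]
  rw [integral_finsetSum]
  · refine Finset.sum_eq_zero fun i _ => integral_conj_mul_eq_zero (key i hf) (key i hg) fun n => ?_
    rw [hc i n hf, hc i n hg]
    rcases h n with h | h <;> simp [h]
  · exact fun i _ => MemLp.integrable_inner_two (key i hf) (key i hg)

theorem ae_eq_zero_of_fourierCoeff_eq_zero [FiniteDimensional ℂ E]
    {f : UnitCirc → E} (hf : MemLp f 2 arcMeasure)
    (h : ∀ n, fourierCoeff f n = 0) : f =ᵐ[arcMeasure] 0 := by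
  have h1 := integral_inner_eq_zero_of_disjoint hf hf fun n => Or.inl (h n)
  rw [← inner_toLp hf hf, inner_self_eq_zero] at h1
  exact hf.coeFn_toLp.symm.trans (h1 ▸ Lp.coeFn_zero E 2 arcMeasure)

/-- Boundary functions of `H²(F)`. -/
structure IsHardy {F : Type*} [NormedAddCommGroup F] [NormedSpace ℂ F] (f : UnitCirc → F) :
    Prop where
  memLp : MemLp f 2 arcMeasure
  fourierCoeff_eq_zero : ∀ n < 0, fourierCoeff f n = 0

theorem IsHardy.integrable {F : Type*} [NormedAddCommGroup F] [NormedSpace ℂ F]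
    {f : UnitCirc → F} (hf : IsHardy f) : Integrable f arcMeasure :=
  MemLp.integrable_of_two hf.memLp

theorem isHardy_const {F : Type*} [NormedAddCommGroup F] [NormedSpace ℂ F] [CompleteSpace F]
    (x : F) : IsHardy (fun _ : UnitCirc => x) :=
  ⟨memLp_const x, fun n hn => by rw [fourierCoeff_const, if_neg hn.ne]⟩

theorem IsHardy.fourier_smul {F : Type*} [NormedAddCommGroup F] [NormedSpace ℂ F]
    {f : UnitCirc → F} (hf : IsHardy f) {k : ℤ} (hk : 0 ≤ k) :
    IsHardy (fun t => fourier k t • f t) :=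
  ⟨memLp_fourier_smul k hf.memLp, fun n hn => by
    rw [fourierCoeff_fourier_smul]
    exact hf.fourierCoeff_eq_zero _ (by omega)⟩

theorem IsHardy.sub {F : Type*} [NormedAddCommGroup F] [NormedSpace ℂ F]
    {f g : UnitCirc → F} (hf : IsHardy f) (hg : IsHardy g) : IsHardy (fun t => f t - g t) :=
  ⟨hf.memLp.sub hg.memLp, fun n hn => by
    rw [fourierCoeff_fun_sub hf.integrable hg.integrable, hf.fourierCoeff_eq_zero n hn,
      hg.fourierCoeff_eq_zero n hn, sub_zero]⟩

theorem IsHardy.sum {F ι : Type*} [NormedAddCommGroup F] [NormedSpace ℂ F] (s : Finset ι)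
    {f : ι → UnitCirc → F} (hf : ∀ i ∈ s, IsHardy (f i)) : IsHardy (fun t => ∑ i ∈ s, f i t) :=
  ⟨memLp_finsetSum s fun i hi => (hf i hi).memLp, fun n hn => by
    rw [fourierCoeff_fun_sum s fun i hi => (hf i hi).integrable]
    exact Finset.sum_eq_zero fun i hi => (hf i hi).fourierCoeff_eq_zero n hn⟩

theorem IsHardy.clm_apply {F G : Type*} [NormedAddCommGroup F] [NormedSpace ℂ F]
    [NormedAddCommGroup G] [NormedSpace ℂ G] [CompleteSpace F] [CompleteSpace G] (L : F →L[ℂ] G)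
    {f : UnitCirc → F} (hf : IsHardy f) : IsHardy (fun t => L (f t)) :=
  ⟨L.comp_memLp' hf.memLp, fun n hn => by
    rw [fourierCoeff_clm_apply L hf.integrable, hf.fourierCoeff_eq_zero n hn, map_zero]⟩

/-- The Riesz projection. -/
theorem exists_isHardy_fourierCoeff_eq {f : UnitCirc → E} (hf : MemLp f 2 arcMeasure) :
    ∃ h : UnitCirc → E, IsHardy h ∧ ∀ n, 0 ≤ n → fourierCoeff h n = fourierCoeff f n := by
  have : CompleteSpace (hardy E 2) := (isClosed_hardy E 2).completeSpace_coe
  let P := (hardy E 2).starProjection (hf.toLp f)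
  have hP : P ∈ hardy E 2 := Submodule.starProjection_apply_mem _ _
  refine ⟨P, ⟨Lp.memLp P, fun n hn => hP n hn⟩, fun n hn => ?_⟩
  have hint : Integrable (fun t => f t - P t) arcMeasure :=
    (MemLp.integrable_of_two hf).sub (MemLp.integrable_of_two (Lp.memLp P))
  suffices h : fourierCoeff (fun t => f t - P t) n = 0 by
    rw [fourierCoeff_fun_sub (MemLp.integrable_of_two hf)
      (MemLp.integrable_of_two (Lp.memLp P)), sub_eq_zero] at h
    exact h.symm
  refine ext_inner_left ℂ fun x => ?_
  rw [inner_fourierCoeff x hint, inner_zero_right]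
  -- For `n ≥ 0` the function `zⁿx` is itself in `H²`, hence orthogonal to the residual `f - P`.
  have hz := (isHardy_const (x : E)).fourier_smul hn
  have hmem : hz.memLp.toLp _ ∈ hardy E 2 := fun m hm => by
    rw [fourierCoeff_congr_ae hz.memLp.coeFn_toLp]
    exact hz.fourierCoeff_eq_zero m hm
  have h := Submodule.starProjection_inner_eq_zero (K := hardy E 2) (hf.toLp f) _ hmem
  rw [← inner_conj_symm, map_eq_zero, L2.inner_def] at h
  rw [← h]
  refine integral_congr_ae ?_
  filter_upwards [hz.memLp.coeFn_toLp, Lp.coeFn_sub (hf.toLp f) P, hf.coeFn_toLp] with t h1 h2 h3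
  rw [h1, h2, Pi.sub_apply, h3]

end Hilbert

/-! ### Operator valued functions, inner functions and their model spaces. -/

section OperatorFunctions

open ContinuousLinearMap (adjoint)

variable {E : Type*} [NormedAddCommGroup E] [InnerProductSpace ℂ E]

theorem memLp_clm_apply_of_right_top {Φ : UnitCirc → E →L[ℂ] E} {f : UnitCirc → E}
    (hΦ : MemLp Φ 2 arcMeasure) (hf : MemLp f ∞ arcMeasure) :
    MemLp (fun t => Φ t (f t)) 2 arcMeasure :=
  (ContinuousLinearMap.id ℂ (E →L[ℂ] E)).memLp_of_bilin 2 hΦ hf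

theorem memLp_clm_apply_of_left_top {p : ℝ≥0∞} {Θ : UnitCirc → E →L[ℂ] E} {f : UnitCirc → E}
    (hΘ : MemLp Θ ∞ arcMeasure) (hf : MemLp f p arcMeasure) :
    MemLp (fun t => Θ t (f t)) p arcMeasure :=
  (ContinuousLinearMap.id ℂ (E →L[ℂ] E)).memLp_of_bilin p hΘ hf

theorem integrable_clm_apply {Φ : UnitCirc → E →L[ℂ] E} {f : UnitCirc → E}
    (hΦ : MemLp Φ 2 arcMeasure) (hf : MemLp f 2 arcMeasure) :
    Integrable (fun t => Φ t (f t)) arcMeasure :=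
  memLp_one_iff_integrable.1 ((ContinuousLinearMap.id ℂ (E →L[ℂ] E)).memLp_of_bilin 1 hΦ hf)

theorem memLp_clm_comp_of_left_top {Θ Φ : UnitCirc → E →L[ℂ] E}
    (hΘ : MemLp Θ ∞ arcMeasure) (hΦ : MemLp Φ 2 arcMeasure) :
    MemLp (fun t => Θ t ∘L Φ t) 2 arcMeasure :=
  (ContinuousLinearMap.compL ℂ E E E).memLp_of_bilin 2 hΘ hΦ

theorem memLp_clm_apply_const {p : ℝ≥0∞} {Φ : UnitCirc → E →L[ℂ] E}
    (hΦ : MemLp Φ p arcMeasure) (x : E) : MemLp (fun t => Φ t x) p arcMeasure :=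
  (ContinuousLinearMap.apply ℂ E x).comp_memLp' hΦ

theorem memLp_fourier_smul_const {p : ℝ≥0∞} (k : ℤ) (x : E) :
    MemLp (fun t : UnitCirc => fourier k t • x) p arcMeasure :=
  memLp_fourier_smul k (memLp_const x)

theorem memLp_backwardShift {p : ℝ≥0∞} {f : UnitCirc → E} (hf : MemLp f p arcMeasure) (x : E) :
    MemLp (fun t => fourier (-1) t • (f t - x)) p arcMeasure :=
  memLp_fourier_smul _ (hf.sub (memLp_const x))

variable [CompleteSpace E]

theorem fourierCoeff_clm_apply_const {Φ : UnitCirc → E →L[ℂ] E} (hΦ : Integrable Φ arcMeasure)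
    (x : E) (n : ℤ) : fourierCoeff (fun t => Φ t x) n = fourierCoeff Φ n x :=
  fourierCoeff_clm_apply (ContinuousLinearMap.apply ℂ E x) hΦ n

theorem memLp_adjoint {p : ℝ≥0∞} {Φ : UnitCirc → E →L[ℂ] E} (hΦ : MemLp Φ p arcMeasure) :
    MemLp (fun t => adjoint (Φ t)) p arcMeasure :=
  hΦ.congr_norm ((adjoint : (E →L[ℂ] E) ≃ₗᵢ⋆[ℂ] _).continuous.comp_aestronglyMeasurable
    hΦ.aestronglyMeasurable)
    (Filter.Eventually.of_forall fun t => (LinearIsometryEquiv.norm_map adjoint (Φ t)).symm)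

theorem fourierCoeff_adjoint {Φ : UnitCirc → E →L[ℂ] E} (hΦ : MemLp Φ 2 arcMeasure) (n : ℤ) :
    fourierCoeff (fun t => adjoint (Φ t)) n = adjoint (fourierCoeff Φ (-n)) := by
  ext y
  refine ext_inner_left ℂ fun x => ?_
  rw [← fourierCoeff_clm_apply_const (MemLp.integrable_of_two (memLp_adjoint hΦ)),
    inner_fourierCoeff x (MemLp.integrable_of_two (memLp_clm_apply_const (memLp_adjoint hΦ) y)),
    ContinuousLinearMap.adjoint_inner_right,
    ← fourierCoeff_clm_apply_const (MemLp.integrable_of_two hΦ), ← inner_conj_symm,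
    inner_fourierCoeff y (MemLp.integrable_of_two (memLp_clm_apply_const hΦ x)), ← integral_conj]
  congr 1
  ext t
  rw [inner_conj_symm, ContinuousLinearMap.adjoint_inner_right, map_smul, inner_smul_left,
    inner_smul_right, fourier_neg]

theorem fourierCoeff_adjoint_apply_fourier {Φ : UnitCirc → E →L[ℂ] E} (hΦ : MemLp Φ 2 arcMeasure)
    (x : E) (k n : ℤ) :
    fourierCoeff (fun t => adjoint (Φ t) (fourier k t • x)) n
      = adjoint (fourierCoeff Φ (k - n)) x := by
  simp_rw [map_smul]
  rw [fourierCoeff_fourier_smul, fourierCoeff_clm_apply_const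
    (MemLp.integrable_of_two (memLp_adjoint hΦ)), fourierCoeff_adjoint hΦ, neg_sub]

/-- Boundary functions of operator valued inner functions. -/
structure IsInnerFun (Θ : UnitCirc → E →L[ℂ] E) : Prop where
  isHardy : IsHardy Θ
  memLp_top : MemLp Θ ∞ arcMeasure
  adjoint_apply : ∀ᵐ t ∂arcMeasure, ∀ x, adjoint (Θ t) (Θ t x) = x

/-- Boundary functions of the model space `K_Θ`. -/
structure IsModel (Θ : UnitCirc → E →L[ℂ] E) (f : UnitCirc → E) : Prop where
  isHardy : IsHardy f
  integral_eq_zero : ∀ h : UnitCirc → E, IsHardy h →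
    ∫ t, inner ℂ (Θ t (h t)) (f t) ∂arcMeasure = 0

variable {Θ : UnitCirc → E →L[ℂ] E}

/-- The polynomial `p` such that `zⁿ x - Θ p` is the projection of `zⁿ x` onto `K_Θ`. -/
def innerPoly (Θ : UnitCirc → E →L[ℂ] E) (n : ℕ) (x : E) (t : UnitCirc) : E :=
  ∑ k ∈ Finset.range (n + 1), fourier (k : ℤ) t • adjoint (fourierCoeff Θ ((n : ℤ) - k)) x

theorem isHardy_innerPoly (Θ : UnitCirc → E →L[ℂ] E) (n : ℕ) (x : E) :
    IsHardy (innerPoly Θ n x) :=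
  IsHardy.sum _ fun k _ => (isHardy_const _).fourier_smul (Int.natCast_nonneg k)

theorem memLp_innerPoly (Θ : UnitCirc → E →L[ℂ] E) (n : ℕ) (x : E) {p : ℝ≥0∞} :
    MemLp (innerPoly Θ n x) p arcMeasure :=
  memLp_finsetSum _ fun k _ => memLp_fourier_smul_const (k : ℤ) _

theorem IsInnerFun.memLp_fourier_sub (hΘ : IsInnerFun Θ) (n : ℕ) (x : E) :
    MemLp (fun t => fourier (n : ℤ) t • x - Θ t (innerPoly Θ n x t)) ∞ arcMeasure :=
  (memLp_fourier_smul_const _ x).sub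
    (memLp_clm_apply_of_left_top hΘ.memLp_top (memLp_innerPoly Θ n x))

variable [FiniteDimensional ℂ E]

theorem ae_eq_zero_of_fourierCoeff_clm_eq_zero {Φ : UnitCirc → E →L[ℂ] E}
    (hΦ : MemLp Φ 2 arcMeasure) (h : ∀ n, fourierCoeff Φ n = 0) : Φ =ᵐ[arcMeasure] 0 := by
  let b := stdOrthonormalBasis ℂ E
  have hb : ∀ i, ∀ᵐ t ∂arcMeasure, Φ t (b i) = 0 := fun i =>
    ae_eq_zero_of_fourierCoeff_eq_zero (memLp_clm_apply_const hΦ (b i)) fun n => by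
      rw [fourierCoeff_clm_apply_const (MemLp.integrable_of_two hΦ), h n]
      rfl
  filter_upwards [ae_all_iff.2 hb] with t ht
  refine ContinuousLinearMap.coe_injective (b.toBasis.ext fun i => ?_)
  simpa using ht i

/-- The product of an operator valued and a vector valued function in `H²` is analytic. -/
theorem IsHardy.fourierCoeff_apply_eq_zero {Φ : UnitCirc → E →L[ℂ] E} {f : UnitCirc → E}
    (hΦ : IsHardy Φ) (hf : IsHardy f) {n : ℤ} (hn : n < 0) :
    fourierCoeff (fun t => Φ t (f t)) n = 0 := by
  refine ext_inner_left ℂ fun x => ?_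
  rw [inner_fourierCoeff x (integrable_clm_apply hΦ.memLp hf.memLp), inner_zero_right]
  -- `Φf` is only integrable, so Parseval is applied after moving `Φ` to the other side: `Φ^*(zⁿx)`
  -- is square integrable with `m`-th coefficient `Φ̂(n-m)^*x`, which vanishes for `m ≥ 0 > n`.
  simp_rw [← ContinuousLinearMap.adjoint_inner_left]
  refine integral_inner_eq_zero_of_disjoint (memLp_clm_apply_of_right_top
    (memLp_adjoint hΦ.memLp) (memLp_fourier_smul_const n x)) hf.memLp fun m => ?_
  rcases lt_or_ge m 0 with hm | hm
  · exact Or.inr (hf.fourierCoeff_eq_zero m hm)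
  · left
    rw [fourierCoeff_adjoint_apply_fourier hΦ.memLp, hΦ.fourierCoeff_eq_zero _ (by omega),
      map_zero, zero_apply]

theorem IsHardy.apply_of_right_top {Φ : UnitCirc → E →L[ℂ] E} {f : UnitCirc → E}
    (hΦ : IsHardy Φ) (hf : IsHardy f) (hf' : MemLp f ∞ arcMeasure) :
    IsHardy (fun t => Φ t (f t)) :=
  ⟨memLp_clm_apply_of_right_top hΦ.memLp hf', fun _ hn => hΦ.fourierCoeff_apply_eq_zero hf hn⟩

theorem IsInnerFun.isHardy_apply (hΘ : IsInnerFun Θ) {h : UnitCirc → E} (hh : IsHardy h) :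
    IsHardy (fun t => Θ t (h t)) :=
  ⟨memLp_clm_apply_of_left_top hΘ.memLp_top hh.memLp,
    fun _ hn => hΘ.isHardy.fourierCoeff_apply_eq_zero hh hn⟩

theorem IsInnerFun.isHardy_comp (hΘ : IsInnerFun Θ) {Γ : UnitCirc → E →L[ℂ] E}
    (hΓ : IsHardy Γ) : IsHardy (fun t => Θ t ∘L Γ t) := by
  have hm := memLp_clm_comp_of_left_top hΘ.memLp_top hΓ.memLp
  refine ⟨hm, fun n hn => ?_⟩
  ext x
  rw [← fourierCoeff_clm_apply_const (MemLp.integrable_of_two hm)]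
  exact (hΘ.isHardy_apply (hΓ.clm_apply (ContinuousLinearMap.apply ℂ E x))).fourierCoeff_eq_zero
    n hn

/-- If the analytic part of `Θ^* u` is `g`, then `u - Θ g` belongs to `K_Θ`. -/
theorem IsInnerFun.isModel_sub (hΘ : IsInnerFun Θ) {u g : UnitCirc → E} (hu : IsHardy u)
    (hg : IsHardy g)
    (h : ∀ n, 0 ≤ n → fourierCoeff g n = fourierCoeff (fun t => adjoint (Θ t) (u t)) n) :
    IsModel Θ (fun t => u t - Θ t (g t)) := by
  refine ⟨hu.sub (hΘ.isHardy_apply hg), fun k hk => ?_⟩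
  have hm : MemLp (fun t => adjoint (Θ t) (u t)) 2 arcMeasure :=
    memLp_clm_apply_of_left_top (memLp_adjoint hΘ.memLp_top) hu.memLp
  have hd : MemLp (fun t => adjoint (Θ t) (u t) - g t) 2 arcMeasure := hm.sub hg.memLp
  -- As `Θ^*Θ = 1`, the pairing of `Θk` with `u - Θg` is that of `k` with `Θ^*u - g`, which has only
  -- negative frequencies.
  rw [← integral_inner_eq_zero_of_disjoint hk.memLp hd fun n => ?_]
  · refine integral_congr_ae ?_
    filter_upwards [hΘ.adjoint_apply] with t ht
    rw [← ContinuousLinearMap.adjoint_inner_right, map_sub, ht]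
  · rcases lt_or_ge n 0 with hn | hn
    · exact Or.inl (hk.fourierCoeff_eq_zero n hn)
    · right
      rw [fourierCoeff_fun_sub (MemLp.integrable_of_two hm) hg.integrable, h n hn, sub_self]

/-- The `m`-th coefficient of `Θ^*(zⁿx)` is `Θ̂(n-m)^*x`, which vanishes for `m > n` because `Θ` is
analytic. Its analytic part is therefore a polynomial, and the resulting elements of `K_Θ` are
bounded. -/
theorem IsInnerFun.isModel_fourier_sub (hΘ : IsInnerFun Θ) (n : ℕ) (x : E) :
    IsModel Θ (fun t => fourier (n : ℤ) t • x - Θ t (innerPoly Θ n x t)) := by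
  refine hΘ.isModel_sub ((isHardy_const x).fourier_smul (Int.natCast_nonneg n))
    (isHardy_innerPoly Θ n x) fun m hm => ?_
  rw [fourierCoeff_adjoint_apply_fourier hΘ.isHardy.memLp]
  unfold innerPoly
  rw [fourierCoeff_fun_sum _ fun (k : ℕ) _ =>
    MemLp.integrable_of_two (memLp_fourier_smul_const (k : ℤ) _)]
  simp_rw [fourierCoeff_fourier_smul, fourierCoeff_const, sub_eq_zero]
  lift m to ℕ using hm
  simp only [Nat.cast_inj]
  rw [Finset.sum_ite_eq]
  split_ifs with h
  · rfl
  · rw [Finset.mem_range] at h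
    rw [hΘ.isHardy.fourierCoeff_eq_zero _ (by omega), map_zero, zero_apply]

/-- The analytic part of a function orthogonal to the bounded functions of `K_Θ` lies in
`Θ H²(E)`. -/
theorem IsInnerFun.exists_isHardy_of_orthogonal (hΘ : IsInnerFun Θ) {v : UnitCirc → E}
    (hv : MemLp v 2 arcMeasure)
    (horth : ∀ f, IsModel Θ f → MemLp f ∞ arcMeasure →
      ∫ t, inner ℂ (f t) (v t) ∂arcMeasure = 0) :
    ∃ g, IsHardy g ∧ ∀ n, 0 ≤ n → fourierCoeff v n = fourierCoeff (fun t => Θ t (g t)) n := by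
  obtain ⟨u, hu, huv⟩ := exists_isHardy_fourierCoeff_eq hv
  obtain ⟨g, hg, hgu⟩ := exists_isHardy_fourierCoeff_eq
    (memLp_clm_apply_of_left_top (memLp_adjoint hΘ.memLp_top) hu.memLp)
  have hw := hΘ.isModel_sub hu hg hgu
  have hΘg := hΘ.isHardy_apply hg
  refine ⟨g, hg, fun n hn => ?_⟩
  rw [← huv n hn, ← sub_eq_zero, ← fourierCoeff_fun_sub hu.integrable hΘg.integrable]
  refine ext_inner_left ℂ fun x => ?_
  rw [inner_fourierCoeff x hw.isHardy.integrable, inner_zero_right]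
  lift n to ℕ using hn
  -- Write `w = u - Θg`, `zⁿx = k + Θp` with `k ∈ K_Θ` bounded. Then `⟨Θp, w⟩ = 0` since `w ∈ K_Θ`,
  -- and `⟨k, w⟩ = ⟨k, u - v⟩ + ⟨k, v⟩ - ⟨k, Θg⟩`, where the terms vanish by disjoint spectra, by
  -- `horth`, and by `k ∈ K_Θ`. Thus `w` has no coefficients of index `≥ 0`.
  have hk := hΘ.isModel_fourier_sub n x
  have hp := isHardy_innerPoly Θ n x
  have h1 := hw.integral_eq_zero _ hp
  have h2 := (integral_inner_eq_zero_comm _ _).1 (hk.integral_eq_zero _ hg)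
  have h3 := horth _ hk (hΘ.memLp_fourier_sub n x)
  have h4 := integral_inner_eq_zero_of_disjoint hk.isHardy.memLp (hu.memLp.sub hv) fun m => by
    rcases lt_or_ge m 0 with hm | hm
    · exact Or.inl (hk.isHardy.fourierCoeff_eq_zero m hm)
    · right
      exact (fourierCoeff_fun_sub hu.integrable (MemLp.integrable_of_two hv) m).trans
        (by rw [huv m hm, sub_self])
  simp only [Pi.sub_apply] at h4
  have i1 := MemLp.integrable_inner_two (hΘ.isHardy_apply hp).memLp hw.isHardy.memLp
  have i2 := MemLp.integrable_inner_two hk.isHardy.memLp hΘg.memLp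
  have i3 := MemLp.integrable_inner_two hk.isHardy.memLp hv
  have i4 := MemLp.integrable_inner_two hk.isHardy.memLp (hu.memLp.sub hv)
  simp only [Pi.sub_apply] at i4
  calc _ = ∫ t, (inner ℂ (Θ t (innerPoly Θ n x t)) (u t - Θ t (g t))
        + (inner ℂ (fourier (n : ℤ) t • x - Θ t (innerPoly Θ n x t)) (u t - v t)
        + inner ℂ (fourier (n : ℤ) t • x - Θ t (innerPoly Θ n x t)) (v t)
        - inner ℂ (fourier (n : ℤ) t • x - Θ t (innerPoly Θ n x t)) (Θ t (g t)))) ∂arcMeasure := by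
        congr 1
        ext t
        simp only [inner_sub_left, inner_sub_right]
        ring
    _ = 0 := by
        rw [integral_add i1 ?_, integral_sub ?_ i2, integral_add i4 i3, h1, h2, h3, h4]
        · simp
        · exact i4.add i3
        · exact (i4.add i3).sub i2

/-- A function orthogonal to the bounded functions of `K_Θ` is orthogonal to `K_Θ`. -/
theorem IsInnerFun.integral_inner_eq_zero_of_orthogonal (hΘ : IsInnerFun Θ) {v f : UnitCirc → E}
    (hv : MemLp v 2 arcMeasure)
    (horth : ∀ f, IsModel Θ f → MemLp f ∞ arcMeasure →
      ∫ t, inner ℂ (f t) (v t) ∂arcMeasure = 0) (hf : IsModel Θ f) :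
    ∫ t, inner ℂ (f t) (v t) ∂arcMeasure = 0 := by
  obtain ⟨g, hg, h⟩ := hΘ.exists_isHardy_of_orthogonal hv horth
  have hΘg := hΘ.isHardy_apply hg
  -- `v - Θg` has only negative frequencies, so `f` pairs with `v` as it does with `Θg`.
  have h1 := integral_inner_eq_zero_of_disjoint hf.isHardy.memLp (hv.sub hΘg.memLp) fun m => by
    rcases lt_or_ge m 0 with hm | hm
    · exact Or.inl (hf.isHardy.fourierCoeff_eq_zero m hm)
    · right
      exact (fourierCoeff_fun_sub (MemLp.integrable_of_two hv) hΘg.integrable m).trans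
        (by rw [h m hm, sub_self])
  have h2 := (integral_inner_eq_zero_comm _ _).1 (hf.integral_eq_zero g hg)
  simp only [Pi.sub_apply, inner_sub_right] at h1
  rw [integral_sub (MemLp.integrable_inner_two hf.isHardy.memLp hv)
    (MemLp.integrable_inner_two hf.isHardy.memLp hΘg.memLp), h2, sub_zero] at h1
  exact h1

/-- `K_Θ` is invariant under the backward shift. -/
theorem IsModel.backwardShift (hΘ : IsInnerFun Θ) {f : UnitCirc → E} (hf : IsModel Θ f) :
    IsModel Θ (fun t => fourier (-1) t • (f t - fourierCoeff f 0)) := by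
  have hs := hf.isHardy.sub (isHardy_const (fourierCoeff f 0))
  refine ⟨⟨memLp_fourier_smul _ hs.memLp, fun n hn => ?_⟩, fun h hh => ?_⟩
  · rw [fourierCoeff_fourier_smul, fourierCoeff_fun_sub hf.isHardy.integrable
      (isHardy_const _).integrable, fourierCoeff_const]
    rcases eq_or_ne n (-1) with rfl | hn'
    · simp
    · rw [if_neg (by omega), hf.isHardy.fourierCoeff_eq_zero _ (by omega), sub_zero]
  · have hz := hh.fourier_smul zero_le_one
    have hΘz := hΘ.isHardy_apply hz
    have h1 := hf.integral_eq_zero _ hz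
    -- The factor `z̄` moves across as `z`, and `zΘh` has zero mean, so the constant `f(0)`
    -- contributes nothing.
    have h2 : ∫ t, inner ℂ (Θ t (fourier 1 t • h t)) (fourierCoeff f 0) ∂arcMeasure = 0 := by
      rw [integral_inner_eq_zero_comm, ← inner_fourierCoeff_zero _ hΘz.integrable]
      simp_rw [map_smul]
      rw [fourierCoeff_fourier_smul, (hΘ.isHardy_apply hh).fourierCoeff_eq_zero _ (by omega),
        inner_zero_right]
    calc _ = ∫ t, (inner ℂ (Θ t (fourier 1 t • h t)) (f t)
          - inner ℂ (Θ t (fourier 1 t • h t)) (fourierCoeff f 0)) ∂arcMeasure := by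
          congr 1
          ext t
          rw [← inner_sub_right, map_smul, inner_smul_left, inner_smul_right, fourier_neg]
      _ = 0 := by
          rw [integral_sub (MemLp.integrable_inner_two hΘz.memLp hf.isHardy.memLp)
            (MemLp.integrable_inner_two hΘz.memLp (memLp_const _)), h1, h2, sub_zero]

/-- The values at the origin of the bounded functions of `K_Θ` fill `E` if `Θ` is pure. -/
theorem IsInnerFun.exists_isModel_fourierCoeff_zero_eq (hΘ : IsInnerFun Θ)
    (hpure : ‖fourierCoeff Θ 0‖ < 1) (x : E) :
    ∃ f, IsModel Θ f ∧ MemLp f ∞ arcMeasure ∧ fourierCoeff f 0 = x := by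
  set T := fourierCoeff Θ 0 with hT
  -- The bounded function `y - ΘT^*y` of `K_Θ` has value `(1 - TT^*)y` at the origin. Since `‖T‖ <
  -- 1`, this operator is injective, hence onto in finite dimension.
  have hinj : Function.Injective ((.id ℂ E - T ∘L adjoint T : E →L[ℂ] E) : E →ₗ[ℂ] E) := by
    rw [← LinearMap.ker_eq_bot, LinearMap.ker_eq_bot']
    intro y hy
    have hy' : T (adjoint T y) = y := by
      exact (sub_eq_zero.1 hy).symm
    by_contra hne
    have h1 : ‖y‖ ≤ ‖T‖ * (‖T‖ * ‖y‖) := by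
      calc ‖y‖ = ‖T (adjoint T y)‖ := by rw [hy']
        _ ≤ ‖T‖ * ‖adjoint T y‖ := T.le_opNorm _
        _ ≤ ‖T‖ * (‖T‖ * ‖y‖) := by
          gcongr
          exact ((adjoint T).le_opNorm y).trans_eq (by rw [LinearIsometryEquiv.norm_map])
    have h2 : 0 < ‖y‖ := norm_pos_iff.2 hne
    have h3 : ‖T‖ * ‖T‖ < 1 := by nlinarith [norm_nonneg T]
    nlinarith
  obtain ⟨y, hy⟩ := LinearMap.injective_iff_surjective.1 hinj x
  refine ⟨_, hΘ.isModel_fourier_sub 0 y, hΘ.memLp_fourier_sub 0 y, ?_⟩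
  rw [fourierCoeff_fun_sub (MemLp.integrable_of_two (memLp_fourier_smul_const _ y))
    (hΘ.isHardy_apply (isHardy_innerPoly Θ 0 y)).integrable, fourierCoeff_fourier_smul,
    fourierCoeff_const]
  have hp : ∀ t, innerPoly Θ 0 y t = adjoint T y := fun t => by
    simp [innerPoly, hT, fourier_zero, -fourier_apply]
  simp_rw [hp]
  rw [fourierCoeff_clm_apply_const hΘ.isHardy.integrable, ← hy]
  simp [hT]

end OperatorFunctions

/-! ### Symbols with vanishing pairings and their decomposition. -/

section NullSymbols

open ContinuousLinearMap (adjoint)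

variable {E : Type*} [NormedAddCommGroup E] [InnerProductSpace ℂ E] [CompleteSpace E]

/-- The symbol `Φ` induces the zero form on `K_{Θ₁}^∞ × K_{Θ₂}^∞`. -/
def IsNullSymbol (Θ₁ Θ₂ Φ : UnitCirc → E →L[ℂ] E) : Prop :=
  ∀ f g, IsModel Θ₁ f → MemLp f ∞ arcMeasure → IsModel Θ₂ g → MemLp g ∞ arcMeasure →
    ∫ t, inner ℂ (g t) (Φ t (f t)) ∂arcMeasure = 0

variable {Θ Θ₁ Θ₂ Φ : UnitCirc → E →L[ℂ] E}

theorem IsNullSymbol.symm (h : IsNullSymbol Θ₁ Θ₂ Φ) :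
    IsNullSymbol Θ₂ Θ₁ (fun t => adjoint (Φ t)) := fun f g hf hf' hg hg' => by
  rw [integral_inner_eq_zero_comm]
  simp_rw [ContinuousLinearMap.adjoint_inner_left]
  exact h g f hg hg' hf hf'

variable [FiniteDimensional ℂ E]

/-- The pairing vanishes both for `(f, g)` and for their backward shifts. In the latter the factors
`z̄` cancel, leaving `⟨g - g(0), Φ(f - f(0))⟩`; expanding it gives the identity. -/
theorem IsNullSymbol.integral_add_integral (h : IsNullSymbol Θ₁ Θ₂ Φ) (hΘ₁ : IsInnerFun Θ₁)
    (hΘ₂ : IsInnerFun Θ₂) (hΦ : MemLp Φ 2 arcMeasure) {f g : UnitCirc → E} (hf : IsModel Θ₁ f)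
    (hf' : MemLp f ∞ arcMeasure) (hg : IsModel Θ₂ g) (hg' : MemLp g ∞ arcMeasure) :
    (∫ t, inner ℂ (g t) (Φ t (fourierCoeff f 0)) ∂arcMeasure)
      + ∫ t, inner ℂ (fourierCoeff g 0) (Φ t (f t)) ∂arcMeasure
      = inner ℂ (fourierCoeff g 0) (fourierCoeff Φ 0 (fourierCoeff f 0)) := by
  have h1 := h f g hf hf' hg hg'
  have h2 := h _ _ (hf.backwardShift hΘ₁) (memLp_backwardShift hf' _) (hg.backwardShift hΘ₂)
    (memLp_backwardShift hg' _)
  have hΦf := memLp_clm_apply_of_right_top hΦ hf'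
  have hΦx := memLp_clm_apply_const hΦ (fourierCoeff f 0)
  have hc : MemLp (fun _ : UnitCirc => fourierCoeff g 0) 2 arcMeasure := memLp_const _
  have i1 := MemLp.integrable_inner_two hg.isHardy.memLp hΦf
  have i2 := MemLp.integrable_inner_two hg.isHardy.memLp hΦx
  have i3 := MemLp.integrable_inner_two hc hΦf
  have i4 := MemLp.integrable_inner_two hc hΦx
  have i5 := MemLp.integrable_inner_two (hg.backwardShift hΘ₂).isHardy.memLp
    (memLp_clm_apply_of_right_top hΦ (memLp_backwardShift hf' (fourierCoeff f 0)))
  rw [← fourierCoeff_clm_apply_const (MemLp.integrable_of_two hΦ),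
    inner_fourierCoeff_zero _ (MemLp.integrable_of_two hΦx), ← integral_add i2 i3, ← sub_eq_zero,
    ← integral_sub ?_ i4, ← sub_zero (0 : ℂ)]
  nth_rewrite 1 [← h1]
  · rw [← h2, ← integral_sub i1 i5]
    congr 1
    ext t
    rw [map_smul, inner_smul_left, inner_smul_right, ← mul_assoc, ← fourier_neg, ← fourier_add,
      map_sub, inner_sub_left, inner_sub_right, inner_sub_right]
    simp only [neg_neg, add_neg_cancel, fourier_zero]
    ring
  · exact i2.add i3

/-- Modulo a constant, the analytic part of a null symbol is divisible by `Θ₂`. -/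
theorem IsNullSymbol.exists_fourierCoeff_eq (h : IsNullSymbol Θ₁ Θ₂ Φ) (hΘ₁ : IsInnerFun Θ₁)
    (hΘ₂ : IsInnerFun Θ₂) (hpure₁ : ‖fourierCoeff Θ₁ 0‖ < 1) (hΦ : MemLp Φ 2 arcMeasure) :
    ∃ (M : E →L[ℂ] E) (Γ : UnitCirc → E →L[ℂ] E), IsHardy Γ ∧ ∀ n, 0 ≤ n →
      fourierCoeff Φ n = fourierCoeff (fun t => Θ₂ t ∘L Γ t) n + if n = 0 then M else 0 := by
  let b := stdOrthonormalBasis ℂ E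
  have key : ∀ x : E, ∃ (m : E) (g : UnitCirc → E), IsHardy g ∧ ∀ n, 0 ≤ n →
      fourierCoeff (fun t => Φ t x) n
        = fourierCoeff (fun t => Θ₂ t (g t)) n + if n = 0 then m else 0 := fun x => by
    obtain ⟨f, hf, hf', rfl⟩ := hΘ₁.exists_isModel_fourierCoeff_zero_eq hpure₁ x
    have hΦf := memLp_clm_apply_of_right_top hΦ hf'
    have hΦx := memLp_clm_apply_const hΦ (fourierCoeff f 0)
    -- With `f` fixed, the identity for null symbols reads `∫⟨g, Φx⟩ = ⟨g(0), m⟩ = ∫⟨g, m⟩` for this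
    -- `m`.
    set m := fourierCoeff Φ 0 (fourierCoeff f 0) - fourierCoeff (fun t => Φ t (f t)) 0 with hm
    have hc : MemLp (fun _ : UnitCirc => m) 2 arcMeasure := memLp_const _
    obtain ⟨g, hg, hgn⟩ := hΘ₂.exists_isHardy_of_orthogonal (hΦx.sub hc) fun g hg hg' => by
      have h1 := h.integral_add_integral hΘ₁ hΘ₂ hΦ hf hf' hg hg'
      rw [← inner_fourierCoeff_zero _ (MemLp.integrable_of_two hΦf), ← eq_sub_iff_add_eq,
        ← inner_sub_right] at h1
      simp only [Pi.sub_apply, inner_sub_right]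
      rw [integral_sub (MemLp.integrable_inner_two hg.isHardy.memLp hΦx)
        (MemLp.integrable_inner_two hg.isHardy.memLp hc), h1, ← hm,
        inner_fourierCoeff_zero_left _ hg.isHardy.integrable, sub_self]
    refine ⟨m, g, hg, fun n hn => ?_⟩
    rw [← hgn n hn, ← sub_eq_iff_eq_add, ← fourierCoeff_const]
    exact (fourierCoeff_fun_sub (MemLp.integrable_of_two hΦx) (MemLp.integrable_of_two hc) n).symm
  choose m g hg hgn using fun i => key (b i)
  -- The functions `g i` become the columns of `Γ` in the basis `b`, as the vectors `m i` do for
  -- `M`.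
  have hΓ : IsHardy fun t => ∑ i, (innerSL ℂ (b i)).smulRight (g i t) :=
    IsHardy.sum _ fun i _ =>
      (hg i).clm_apply (ContinuousLinearMap.smulRightL ℂ E E (innerSL ℂ (b i)))
  refine ⟨∑ i, (innerSL ℂ (b i)).smulRight (m i), _, hΓ, fun n hn => ?_⟩
  refine ContinuousLinearMap.coe_injective (b.toBasis.ext fun j => ?_)
  have hsum : ∀ y : Fin (Module.finrank ℂ E) → E,
      (∑ i, (innerSL ℂ (b i)).smulRight (y i) : E →L[ℂ] E) (b j) = y j := fun y => by
    simp [b.inner_eq_ite]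
  have hj := hgn j n hn
  rw [fourierCoeff_clm_apply_const (MemLp.integrable_of_two hΦ)] at hj
  simp only [OrthonormalBasis.coe_toBasis, ContinuousLinearMap.coe_coe, add_apply]
  rw [hj, ← fourierCoeff_clm_apply_const (hΘ₂.isHardy_comp hΓ).integrable]
  simp only [ContinuousLinearMap.comp_apply, hsum]
  congr 1
  split_ifs
  · exact (hsum m).symm
  · rfl

/-- Against `g ∈ K_Θ`, both the antianalytic part of `Φx` and the term `ΘΓx` drop out; only the
constant `Mx` survives. This serves to compare the constants obtained from `Φ` and from `Φ^*`. -/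
theorem IsModel.integral_inner_apply_eq (hΘ : IsInnerFun Θ) (hΦ : MemLp Φ 2 arcMeasure)
    {M : E →L[ℂ] E} {Γ : UnitCirc → E →L[ℂ] E} (hΓ : IsHardy Γ)
    (h : ∀ n, 0 ≤ n →
      fourierCoeff Φ n = fourierCoeff (fun t => Θ t ∘L Γ t) n + if n = 0 then M else 0)
    {g : UnitCirc → E} (hg : IsModel Θ g) (x : E) :
    ∫ t, inner ℂ (g t) (Φ t x) ∂arcMeasure = inner ℂ (fourierCoeff g 0) (M x) := by
  have hΘΓ := hΘ.isHardy_comp hΓ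
  have hΦx := memLp_clm_apply_const hΦ x
  have hΓx := memLp_clm_apply_const hΘΓ.memLp x
  have hc : MemLp (fun _ : UnitCirc => M x) 2 arcMeasure := memLp_const _
  have h1 : ∫ t, inner ℂ (g t) ((Θ t ∘L Γ t) x) ∂arcMeasure = 0 :=
    (integral_inner_eq_zero_comm _ _).1
    (hg.integral_eq_zero _ (hΓ.clm_apply (ContinuousLinearMap.apply ℂ E x)))
  have h2 := integral_inner_eq_zero_of_disjoint hg.isHardy.memLp ((hΦx.sub hΓx).sub hc) fun n => by
    rcases lt_or_ge n 0 with hn | hn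
    · exact Or.inl (hg.isHardy.fourierCoeff_eq_zero n hn)
    · right
      refine (fourierCoeff_fun_sub (MemLp.integrable_of_two (hΦx.sub hΓx))
        (MemLp.integrable_of_two hc) n).trans ?_
      rw [sub_eq_zero]
      refine (fourierCoeff_fun_sub (MemLp.integrable_of_two hΦx)
        (MemLp.integrable_of_two hΓx) n).trans ?_
      rw [fourierCoeff_clm_apply_const (MemLp.integrable_of_two hΦ),
        fourierCoeff_clm_apply_const hΘΓ.integrable, h n hn, fourierCoeff_const, add_apply,
        add_sub_cancel_left]
      split_ifs <;> rfl
  have i1 := MemLp.integrable_inner_two hg.isHardy.memLp hΦx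
  have i2 := MemLp.integrable_inner_two hg.isHardy.memLp hΓx
  have i3 := MemLp.integrable_inner_two hg.isHardy.memLp hc
  simp only [Pi.sub_apply, inner_sub_right] at h2
  rw [integral_sub ?_ i3, integral_sub i1 i2] at h2
  · rw [inner_fourierCoeff_zero_left _ hg.isHardy.integrable]
    linear_combination h2 + h1
  · exact i1.sub i2

/-- A null symbol lies in `[Θ₁ H²(L(E))]^* + Θ₂ H²(L(E))`. -/
theorem IsNullSymbol.exists_ae_eq (h : IsNullSymbol Θ₁ Θ₂ Φ) (hΘ₁ : IsInnerFun Θ₁)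
    (hΘ₂ : IsInnerFun Θ₂) (hpure₁ : ‖fourierCoeff Θ₁ 0‖ < 1) (hpure₂ : ‖fourierCoeff Θ₂ 0‖ < 1)
    (hΦ : MemLp Φ 2 arcMeasure) :
    ∃ Γ₁ Γ₂ : UnitCirc → E →L[ℂ] E, IsHardy Γ₁ ∧ IsHardy Γ₂ ∧
      ∀ᵐ t ∂arcMeasure, Φ t = adjoint (Θ₁ t ∘L Γ₁ t) + Θ₂ t ∘L Γ₂ t := by
  have hΦ' := memLp_adjoint hΦ
  obtain ⟨M, Γ₂, hΓ₂, hM⟩ := h.exists_fourierCoeff_eq hΘ₁ hΘ₂ hpure₁ hΦ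
  obtain ⟨N, Γ₁, hΓ₁, hN⟩ := h.symm.exists_fourierCoeff_eq hΘ₂ hΘ₁ hpure₂ hΦ'
  have h₁ := hΘ₁.isHardy_comp hΓ₁
  have h₂ := hΘ₂.isHardy_comp hΓ₂
  -- The two integrals in `IsNullSymbol.integral_add_integral` are `⟨g(0), M f(0)⟩` and `⟨g(0), N^*
  -- f(0)⟩`; by purity of both inner functions, `f(0)` and `g(0)` are arbitrary.
  have hMN : M + adjoint N = fourierCoeff Φ 0 := by
    ext x
    refine ext_inner_left ℂ fun y => ?_
    obtain ⟨f, hf, hf', rfl⟩ := hΘ₁.exists_isModel_fourierCoeff_zero_eq hpure₁ x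
    obtain ⟨g, hg, hg', rfl⟩ := hΘ₂.exists_isModel_fourierCoeff_zero_eq hpure₂ y
    rw [← h.integral_add_integral hΘ₁ hΘ₂ hΦ hf hf' hg hg',
      hg.integral_inner_apply_eq hΘ₂ hΦ hΓ₂ hM, integral_inner_conj]
    simp_rw [← ContinuousLinearMap.adjoint_inner_right (Φ _)]
    rw [hf.integral_inner_apply_eq hΘ₁ hΦ' hΓ₁ hN, inner_conj_symm, add_apply, inner_add_right,
      ContinuousLinearMap.adjoint_inner_right]
  refine ⟨Γ₁, Γ₂, hΓ₁, hΓ₂, ?_⟩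
  have h₁' := memLp_adjoint h₁.memLp
  have hz := ae_eq_zero_of_fourierCoeff_clm_eq_zero ((hΦ.sub h₁').sub h₂.memLp) fun n => by
    refine (fourierCoeff_fun_sub (MemLp.integrable_of_two (hΦ.sub h₁')) h₂.integrable n).trans ?_
    rw [sub_eq_zero]
    refine (fourierCoeff_fun_sub (MemLp.integrable_of_two hΦ)
      (MemLp.integrable_of_two h₁') n).trans ?_
    rw [fourierCoeff_adjoint h₁.memLp]
    rcases lt_trichotomy n 0 with hn | rfl | hn
    · have hn' := hN (-n) (by omega)
      rw [fourierCoeff_adjoint hΦ, neg_neg, if_neg (by omega), add_zero] at hn'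
      rw [← hn', ContinuousLinearMap.adjoint_adjoint, h₂.fourierCoeff_eq_zero n hn, sub_self]
    -- Both halves contribute at index `0`: their sum is `(Φ̂(0) - N^*) + (Φ̂(0) - M)`, which is
    -- `Φ̂(0)` by `hMN`.
    · have hN0 := hN 0 le_rfl
      have hM0 := hM 0 le_rfl
      rw [fourierCoeff_adjoint hΦ, neg_zero, if_pos rfl, ← sub_eq_iff_eq_add] at hN0
      rw [if_pos rfl, ← sub_eq_iff_eq_add] at hM0
      rw [neg_zero, ← hN0, ← hM0, map_sub, ContinuousLinearMap.adjoint_adjoint, ← hMN]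
      abel
    · rw [hM n hn.le, h₁.fourierCoeff_eq_zero _ (by omega), if_neg hn.ne', map_zero]
      simp
  filter_upwards [hz] with t ht
  simp only [Pi.sub_apply, Pi.zero_apply] at ht
  rw [sub_sub, sub_eq_zero] at ht
  exact ht

/-- Boundedness of `f` and `g` keeps `Γ₂f` and `Γ₁g` in `H²`, so `Θ₂(Γ₂f)` is orthogonal to `g` and
`Θ₁(Γ₁g)` to `f`. -/
theorem isNullSymbol_of_ae_eq {Γ₁ Γ₂ : UnitCirc → E →L[ℂ] E}
    (hΘ₁ : IsInnerFun Θ₁) (hΘ₂ : IsInnerFun Θ₂) (hΓ₁ : IsHardy Γ₁) (hΓ₂ : IsHardy Γ₂)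
    (h : ∀ᵐ t ∂arcMeasure, Φ t = adjoint (Θ₁ t ∘L Γ₁ t) + Θ₂ t ∘L Γ₂ t) :
    IsNullSymbol Θ₁ Θ₂ Φ := fun f g hf hf' hg hg' => by
  have hf₂ := hΓ₂.apply_of_right_top hf.isHardy hf'
  have hg₁ := hΓ₁.apply_of_right_top hg.isHardy hg'
  have h1 := hf.integral_eq_zero _ hg₁
  have h2 := (integral_inner_eq_zero_comm _ _).1 (hg.integral_eq_zero _ hf₂)
  rw [← add_zero (0 : ℂ)]
  nth_rewrite 1 [← h1]
  rw [← h2, ← integral_add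
    (MemLp.integrable_inner_two (hΘ₁.isHardy_apply hg₁).memLp hf.isHardy.memLp)
    (MemLp.integrable_inner_two hg.isHardy.memLp (hΘ₂.isHardy_apply hf₂).memLp)]
  refine integral_congr_ae ?_
  filter_upwards [h] with t ht
  rw [ht, add_apply, inner_add_right, ContinuousLinearMap.adjoint_inner_right]
  rfl

end NullSymbols

/-! ### From `Lp` classes and operators to boundary functions and pairings. -/

section Translation

open ContinuousLinearMap (adjoint)

variable {E : Type*} [NormedAddCommGroup E] [InnerProductSpace ℂ E]

theorem isHardy_coe {F : Type*} [NormedAddCommGroup F] [NormedSpace ℂ F] {f : LpC F 2}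
    (hf : f ∈ hardy F 2) : IsHardy (f : UnitCirc → F) :=
  ⟨Lp.memLp f, hf⟩

theorem IsHardy.toLp_mem_hardy {F : Type*} [NormedAddCommGroup F] [NormedSpace ℂ F]
    {f : UnitCirc → F} (hf : IsHardy f) : hf.memLp.toLp f ∈ hardy F 2 := fun n hn => by
  rw [fourierCoeff_congr_ae hf.memLp.coeFn_toLp]
  exact hf.fourierCoeff_eq_zero n hn

theorem IsHardy.congr {F : Type*} [NormedAddCommGroup F] [NormedSpace ℂ F]
    {f g : UnitCirc → F} (hf : IsHardy f) (h : f =ᵐ[arcMeasure] g) : IsHardy g :=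
  ⟨hf.memLp.ae_eq h, by rw [← fourierCoeff_congr_ae h]; exact hf.fourierCoeff_eq_zero⟩

theorem IsPure.norm_fourierCoeff_lt {Θ : LpC (E →L[ℂ] E) ∞} (h : IsPure Θ) :
    ‖fourierCoeff (Θ : UnitCirc → E →L[ℂ] E) 0‖ < 1 := by
  rw [← discValue_zero]
  exact h

theorem mem_modelSpace_iff [CompleteSpace E] {Θ : LpC (E →L[ℂ] E) ∞} {f : LpC E 2} :
    f ∈ modelSpace Θ ↔ IsModel Θ f := by
  have key : ∀ h : LpC E 2,
      inner ℂ ((ContinuousLinearMap.id ℂ (E →L[ℂ] E)).holder 2 Θ h) f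
        = ∫ t, inner ℂ (Θ t (h t)) (f t) ∂arcMeasure := fun h => by
    rw [L2.inner_def]
    refine integral_congr_ae ?_
    filter_upwards [ContinuousLinearMap.coeFn_holder (r := 2)
      (ContinuousLinearMap.id ℂ (E →L[ℂ] E)) Θ h] with t ht
    rw [ht]
    rfl
  constructor
  · rintro ⟨h1, h2⟩
    refine ⟨isHardy_coe h1, fun h hh => ?_⟩
    rw [← (Submodule.mem_orthogonal _ _).1 h2 _ (Submodule.mem_map_of_mem hh.toLp_mem_hardy)]
    refine Eq.trans ?_ (key _).symm
    refine integral_congr_ae ?_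
    filter_upwards [hh.memLp.coeFn_toLp] with t ht
    rw [ht]
  · intro hf
    refine ⟨hf.isHardy.fourierCoeff_eq_zero, (Submodule.mem_orthogonal _ _).2 ?_⟩
    rintro _ ⟨h, hh, rfl⟩
    exact (key h).trans (hf.integral_eq_zero _ (isHardy_coe hh))

theorem IsModel.congr [CompleteSpace E] {Θ : UnitCirc → E →L[ℂ] E} {f g : UnitCirc → E}
    (hf : IsModel Θ f) (h : f =ᵐ[arcMeasure] g) : IsModel Θ g :=
  ⟨hf.isHardy.congr h, fun k hk => by
    rw [← hf.integral_eq_zero k hk]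
    refine integral_congr_ae ?_
    filter_upwards [h] with t ht
    rw [ht]⟩

variable [CompleteSpace E]

theorem IsInner.isInnerFun {Θ : LpC (E →L[ℂ] E) ∞} (h : IsInner Θ) :
    IsInnerFun (Θ : UnitCirc → E →L[ℂ] E) := by
  refine ⟨⟨(Lp.memLp Θ).mono_exponent le_top, h.mem_hardy⟩, Lp.memLp Θ, ?_⟩
  filter_upwards [h.isometry] with t ht x
  have hn := (ContinuousLinearMap.norm_map_iff_adjoint_comp_self (Θ t)).1 fun x =>
    (AddMonoidHomClass.isometry_iff_norm (Θ t)).1 ht x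
  exact congrArg (fun T : E →L[ℂ] E => T x) hn

theorem mem_mulHardyOp_iff [FiniteDimensional ℂ E] {Θ : LpC (E →L[ℂ] E) ∞}
    {Ψ : LpC (E →L[ℂ] E) 2} :
    Ψ ∈ mulHardyOp Θ ↔ ∃ Γ : UnitCirc → E →L[ℂ] E, IsHardy Γ ∧
      ∀ᵐ t ∂arcMeasure, Ψ t = Θ t ∘L Γ t := by
  have key : ∀ Γ : LpC (E →L[ℂ] E) 2, ∀ᵐ t ∂arcMeasure,
      (ContinuousLinearMap.compL ℂ E E E).holder 2 Θ Γ t = Θ t ∘L Γ t := fun Γ =>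
    ContinuousLinearMap.coeFn_holder (r := 2) (ContinuousLinearMap.compL ℂ E E E) Θ Γ
  constructor
  · rintro ⟨Γ, hΓ, rfl⟩
    exact ⟨Γ, isHardy_coe hΓ, key Γ⟩
  · rintro ⟨Γ, hΓ, h⟩
    refine ⟨_, hΓ.toLp_mem_hardy, Lp.ext ?_⟩
    filter_upwards [h, key (hΓ.memLp.toLp Γ), hΓ.memLp.coeFn_toLp] with t h1 h2 h3
    rw [h1, ← h3]
    exact h2

theorem mem_star_mulHardyOp_add_iff [FiniteDimensional ℂ E] {Θ₁ Θ₂ : LpC (E →L[ℂ] E) ∞}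
    {Φ : LpC (E →L[ℂ] E) 2} :
    Φ ∈ star (mulHardyOp Θ₁ : Set (LpC (E →L[ℂ] E) 2)) + (mulHardyOp Θ₂ : Set (LpC (E →L[ℂ] E) 2))
      ↔ ∃ Γ₁ Γ₂ : UnitCirc → E →L[ℂ] E, IsHardy Γ₁ ∧ IsHardy Γ₂ ∧
        ∀ᵐ t ∂arcMeasure, Φ t = adjoint (Θ₁ t ∘L Γ₁ t) + Θ₂ t ∘L Γ₂ t := by
  rw [Set.mem_add]
  constructor
  · rintro ⟨Ψ₁, h₁, Ψ₂, h₂, rfl⟩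
    obtain ⟨Γ₁, hΓ₁, e₁⟩ := mem_mulHardyOp_iff.1 (Set.mem_star.1 h₁)
    obtain ⟨Γ₂, hΓ₂, e₂⟩ := mem_mulHardyOp_iff.1 h₂
    refine ⟨Γ₁, Γ₂, hΓ₁, hΓ₂, ?_⟩
    filter_upwards [e₁, e₂, Lp.coeFn_add Ψ₁ Ψ₂, Lp.coeFn_star Ψ₁] with t h1 h2 h3 h4
    rw [h3, Pi.add_apply, h2, ← h1, h4, Pi.star_apply, ContinuousLinearMap.star_eq_adjoint,
      ContinuousLinearMap.adjoint_adjoint]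
  · rintro ⟨Γ₁, Γ₂, hΓ₁, hΓ₂, h⟩
    have m₁ := memLp_clm_comp_of_left_top (Lp.memLp Θ₁) hΓ₁.memLp
    have m₂ := memLp_clm_comp_of_left_top (Lp.memLp Θ₂) hΓ₂.memLp
    refine ⟨star (m₁.toLp _), ?_, m₂.toLp _, mem_mulHardyOp_iff.2 ⟨Γ₂, hΓ₂, m₂.coeFn_toLp⟩,
      Lp.ext ?_⟩
    · rw [Set.mem_star, star_star]
      exact mem_mulHardyOp_iff.2 ⟨Γ₁, hΓ₁, m₁.coeFn_toLp⟩
    · filter_upwards [h, Lp.coeFn_add (star (m₁.toLp _)) (m₂.toLp _), Lp.coeFn_star (m₁.toLp _),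
        m₁.coeFn_toLp, m₂.coeFn_toLp] with t h1 h2 h3 h4 h5
      rw [h2, Pi.add_apply, h3, Pi.star_apply, h4, h5, h1, ContinuousLinearMap.star_eq_adjoint]

theorem IsATTO.inner_apply {Θ₁ Θ₂ : LpC (E →L[ℂ] E) ∞} {Φ : LpC (E →L[ℂ] E) 2}
    {A : modelSpace Θ₁ →L[ℂ] modelSpace Θ₂} (hA : IsATTO Θ₁ Θ₂ Φ A) {f : modelSpace Θ₁}
    (hf : MemLp ((f : LpC E 2) : UnitCirc → E) ∞ arcMeasure) (g : modelSpace Θ₂) :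
    inner ℂ g (A f) = ∫ t, inner ℂ ((g : LpC E 2) t) (Φ t ((f : LpC E 2) t)) ∂arcMeasure := by
  rw [hA f hf, Submodule.inner_orthogonalProjectionOnto_eq_of_mem_left, L2.inner_def]
  refine integral_congr_ae ?_
  filter_upwards [ContinuousLinearMap.coeFn_holder (r := 2)
    (ContinuousLinearMap.id ℂ (E →L[ℂ] E)) Φ (hf.toLp _), hf.coeFn_toLp] with t h1 h2
  rw [mulVec, h1, h2]
  rfl

/-- The symbol formula is available only on bounded `f`, and null symbols are tested only on bounded
`g`. Each restriction is removed by `IsInnerFun.integral_inner_eq_zero_of_orthogonal`, in `K_{Θ₂}`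
for `g` and in `K_{Θ₁}` for `f`. -/
theorem IsATTO.eq_zero_iff [FiniteDimensional ℂ E] {Θ₁ Θ₂ : LpC (E →L[ℂ] E) ∞}
    (hΘ₁ : IsInner Θ₁) (hΘ₂ : IsInner Θ₂) {Φ : LpC (E →L[ℂ] E) 2}
    {A : modelSpace Θ₁ →L[ℂ] modelSpace Θ₂} (hA : IsATTO Θ₁ Θ₂ Φ A) :
    A = 0 ↔ IsNullSymbol (Θ₁ : UnitCirc → E →L[ℂ] E) Θ₂ Φ := by
  constructor
  · rintro rfl f g hf hf' hg hg'
    have ef := hf.isHardy.memLp.coeFn_toLp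
    have eg := hg.isHardy.memLp.coeFn_toLp
    let F : modelSpace Θ₁ := ⟨_, mem_modelSpace_iff.2 (hf.congr ef.symm)⟩
    let G : modelSpace Θ₂ := ⟨_, mem_modelSpace_iff.2 (hg.congr eg.symm)⟩
    have h := hA.inner_apply (f := F) (hf'.ae_eq ef.symm) G
    rw [zero_apply, inner_zero_right] at h
    rw [h]
    refine integral_congr_ae ?_
    filter_upwards [ef, eg] with t h1 h2
    rw [h1, h2]
  · intro h
    have hbdd : ∀ f : modelSpace Θ₁, MemLp ((f : LpC E 2) : UnitCirc → E) ∞ arcMeasure →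
        A f = 0 := fun f hf => by
      refine ext_inner_left ℂ fun g => ?_
      rw [hA.inner_apply hf, inner_zero_right]
      exact hΘ₂.isInnerFun.integral_inner_eq_zero_of_orthogonal
        (memLp_clm_apply_of_right_top (Lp.memLp Φ) hf)
        (fun g hg hg' => h _ g (mem_modelSpace_iff.1 f.2) hf hg hg') (mem_modelSpace_iff.1 g.2)
    ext1 f
    refine ext_inner_right ℂ fun g => ?_
    -- `A` kills bounded functions, so `A^*g` is orthogonal to all bounded elements of `K_{Θ₁}`,
    -- hence to every element.
    rw [← ContinuousLinearMap.adjoint_inner_right, zero_apply, inner_zero_left,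
      Submodule.coe_inner, L2.inner_def]
    refine hΘ₁.isInnerFun.integral_inner_eq_zero_of_orthogonal (Lp.memLp _) (fun f hf hf' => ?_)
      (mem_modelSpace_iff.1 f.2)
    have ef := hf.isHardy.memLp.coeFn_toLp
    let F : modelSpace Θ₁ := ⟨_, mem_modelSpace_iff.2 (hf.congr ef.symm)⟩
    have h0 : inner ℂ F (adjoint A g) = 0 := by
      rw [ContinuousLinearMap.adjoint_inner_right, hbdd F (hf'.ae_eq ef.symm), inner_zero_left]
    rw [← h0, Submodule.coe_inner, L2.inner_def]
    refine integral_congr_ae ?_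
    filter_upwards [ef] with t h1
    rw [h1]

end Translation

end MatrixATTO

end

theorem mainTheorem1 {E : Type*} [NormedAddCommGroup E] [InnerProductSpace ℂ E] [CompleteSpace E]
    [FiniteDimensional ℂ E]
    (Θ₁ Θ₂ : MatrixATTO.LpC (E →L[ℂ] E) ∞)
    (hΘ₁ : MatrixATTO.IsInner Θ₁) (hΘ₂ : MatrixATTO.IsInner Θ₂)
    (hnc₁ : MatrixATTO.IsNonconstant Θ₁) (hnc₂ : MatrixATTO.IsNonconstant Θ₂)
    (hpure₁ : MatrixATTO.IsPure Θ₁) (hpure₂ : MatrixATTO.IsPure Θ₂)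
    (Φ : MatrixATTO.LpC (E →L[ℂ] E) 2)
    (A : MatrixATTO.modelSpace Θ₁ →L[ℂ] MatrixATTO.modelSpace Θ₂)
    (hA : MatrixATTO.IsATTO Θ₁ Θ₂ Φ A) :
    A = 0 ↔
      Φ ∈ star (MatrixATTO.mulHardyOp Θ₁ : Set (MatrixATTO.LpC (E →L[ℂ] E) 2)) +
        (MatrixATTO.mulHardyOp Θ₂ : Set (MatrixATTO.LpC (E →L[ℂ] E) 2)) := by
  rw [hA.eq_zero_iff hΘ₁ hΘ₂, MatrixATTO.mem_star_mulHardyOp_add_iff]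
  exact ⟨fun h => h.exists_ae_eq hΘ₁.isInnerFun hΘ₂.isInnerFun hpure₁.norm_fourierCoeff_lt
    hpure₂.norm_fourierCoeff_lt (Lp.memLp Φ), fun ⟨_, _, h₁, h₂, h⟩ =>
    MatrixATTO.isNullSymbol_of_ae_eq hΘ₁.isInnerFun hΘ₂.isInnerFun h₁ h₂ h⟩
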